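/- Let $\mathcal X,\mathcal Y$ be finite alphabets and let $p_{Y|X}$ be a discrete memoryless channel from $\mathcal X$ to $\mathcal Y$. Let $\alpha:\mathcal X\to\mathbb R$ and let $\rho_0\in\mathbb R$ satisfy $\rho_0\ge\min_x\alpha(x)$. Rates and mutual information are measured in nats. A block code of length $N$ with $M$ messages consists of an encoder $\{1,\dots,M\}\to\mathcal X^N$ and a decoder $\mathcal Y^N\to\{1,\dots,M\}$. With the message uniformly distributed and $X_n$ the $n$-th channel input, the code satisfies the cost constraint if $$\frac1N\sum_{n=1}^N \mathrm E[\alpha(X_n)]\le\rho_0 ,$$ and its error probability is the probability that the decoded message differs from the sent one. A rate $R$ is achievable if for every $\varepsilon>0$ and all sufficiently large $N$ there is a code of length $N$ with $\lceil e^{NR}\rceil$ messages that satisfies the cost constraint and has error probability at most $\varepsilon$. The capacity is the supremum of the achievable rates. For an input distribution $p_X$ on $\mathcal X$ let $I(X;Y)$ be the mutual information of $X\sim p_X$ and the channel output $Y$, and for $\lambda\ge0$ let $$L_1(\lambda,\rho_0)=\max_{p_X}\bigl[I(X;Y)-\lambda\,(\mathrm E[\alpha(X)]-\rho_0)\bigr].$$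 Then the maximum defining $L_1(\lambda,\rho_0)$ is attained for every $\lambda\ge 0$; the capacity $C_1$ under the cost constraint is finite; and $$C_1=\inf_{\lambda\ge0}L_1(\lambda,\rho_0)=R_1:=\max_{p_X:\ \mathrm E[\alpha(X)]\le\rho_0}I(X;Y),$$ where the maximum in $R_1$ is attained. If moreover $\rho_0>\min_x\alpha(x)$, or if $\alpha(x)\le\rho_0$ for all $x$, the infimum is attained, so that $$C_1=\min_{\lambda\ge0}L_1(\lambda,\rho_0).$$ Finally, whenever $\lambda^*\ge0$ satisfies $L_1(\lambda^*,\rho_0)=C_1$, then for every $N$ and all inputs $X_1,\dots,X_N$ with $\frac1N\sum_{n=1}^N\mathrm E[\alpha(X_n)]\le\rho_0$ and corresponding channel outputs $Y_1,\dots,Y_N$, $$\sum_{n=1}^N I(X_n;Y_n)\le\sum_{n=1}^N\Bigl(I(X_n;Y_n)-\lambda^*\bigl(\mathrm E[\alpha(X_n)]-\rho_0\bigr)\Bigr)\le N C_1 .$$ -/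

import Mathlib

open Filter

noncomputable section

/-- A discrete memoryless channel with input alphabet `X` and output alphabet `Y`:
`W x y` is the probability of the output letter `y` when the input letter is `x`. -/
def IsChannel {X Y : Type*} [Fintype Y] (W : X → Y → ℝ) : Prop :=
  ∀ x, W x ∈ stdSimplex ℝ Y

/-- The expected cost `E[α(X)]` when `X` has distribution `p`. -/
def expectedCost {X : Type*} [Fintype X] (α : X → ℝ) (p : X → ℝ) : ℝ :=
  ∑ x, p x * α x

/-- The mutual information, in nats, of a pair with joint probability mass function `P`.
A pair `(x, y)` with `P x y = 0` contributes `0`, as usual; otherwise both marginals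
at that pair are positive. -/
def jointMutualInfo {X Y : Type*} [Fintype X] [Fintype Y] (P : X → Y → ℝ) : ℝ :=
  ∑ x, ∑ y, P x y * Real.log (P x y / ((∑ y', P x y') * (∑ x', P x' y)))

/-- `I(X;Y)` when `X` has distribution `p` and `Y` is the output of the channel `W`. -/
def mutualInfo {X Y : Type*} [Fintype X] [Fintype Y] (W : X → Y → ℝ) (p : X → ℝ) : ℝ :=
  jointMutualInfo fun x y => p x * W x y

/-- The Lagrangian `I(X;Y) - lam * (E[α(X)] - ρ)` at the input distribution `p`. -/
def lagrangian {X Y : Type*} [Fintype X] [Fintype Y] (W : X → Y → ℝ) (α : X → ℝ)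
    (lam ρ : ℝ) (p : X → ℝ) : ℝ :=
  mutualInfo W p - lam * (expectedCost α p - ρ)

/-- The Lagrange dual function: the supremum of the Lagrangian over all input distributions. -/
def dualFunction {X Y : Type*} [Fintype X] [Fintype Y] (W : X → Y → ℝ) (α : X → ℝ)
    (lam ρ : ℝ) : ℝ :=
  sSup (lagrangian W α lam ρ '' stdSimplex ℝ X)

/-- The input distributions that satisfy the cost constraint `E[α(X)] ≤ ρ`. -/
def feasibleInputs {X : Type*} [Fintype X] (α : X → ℝ) (ρ : ℝ) : Set (X → ℝ) :=
  {p | p ∈ stdSimplex ℝ X ∧ expectedCost α p ≤ ρ}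

/-- A block code with `M` messages and block length `N`. -/
structure BlockCode (X Y : Type*) (M N : ℕ) where
  /-- the encoder: `enc m n` is the `n`-th channel input when the message is `m` -/
  enc : Fin M → Fin N → X
  /-- the decoder -/
  dec : (Fin N → Y) → Fin M

/-- `(1/N) ∑ₙ E[α(Xₙ)]`, the expectation being over a uniformly distributed message. -/
def BlockCode.averageCost {X Y : Type*} {M N : ℕ} (c : BlockCode X Y M N) (α : X → ℝ) : ℝ :=
  (1 / (N : ℝ)) * ∑ n, (1 / (M : ℝ)) * ∑ m, α (c.enc m n)

/-- The probability that the decoded message differs from the sent one, for a uniformly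
distributed message and `N` memoryless uses of the channel `W`. -/
def BlockCode.errorProb {X Y : Type*} [Fintype Y] {M N : ℕ} (c : BlockCode X Y M N)
    (W : X → Y → ℝ) : ℝ :=
  (1 / (M : ℝ)) * ∑ m, ∑ y : Fin N → Y with c.dec y ≠ m, ∏ n, W (c.enc m n) (y n)

/-- The rate `R` (nats per channel use) is achievable under the average cost constraint `ρ`:
for all large `N` there are codes with `⌈exp (N R)⌉` messages that satisfy the constraint and
whose error probability tends to `0`. -/
def IsAchievable {X Y : Type*} [Fintype Y] (W : X → Y → ℝ) (α : X → ℝ) (ρ R : ℝ) : Prop :=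
  ∀ ε : ℝ, 0 < ε → ∀ᶠ N : ℕ in atTop,
    ∃ c : BlockCode X Y ⌈Real.exp ((N : ℝ) * R)⌉₊ N,
      c.averageCost α ≤ ρ ∧ c.errorProb W ≤ ε

/-- `C` is the capacity under the average cost constraint `ρ`: the least upper bound of the
achievable rates (a set that has to be nonempty and bounded above for this to hold). -/
def IsCapacity {X Y : Type*} [Fintype Y] (W : X → Y → ℝ) (α : X → ℝ) (ρ C : ℝ) : Prop :=
  IsLUB {R | IsAchievable W α ρ R} C

end

/-!
Capacity of a discrete memoryless channel under an average cost constraint, through Lagrange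
duality.

*Duality.* The mutual information `I(X;Y) = H(Y) - H(Y|X)` is continuous and concave in the input
distribution (`continuousOn_mutualInfo`, `concaveOn_mutualInfo`), so every maximum over the compact
simplex is attained. The Lagrangian is concave in the input and affine in the multiplier; Sion's
minimax theorem on the simplex then gives `inf L₁ = R₁` (`exists_dualFunction_lt`,
`isGLB_dualFunction`), also in the degenerate case `ρ₀ = min α`, where the infimum may fail to be
attained. If some letter costs less than `ρ₀`, nearly optimal multipliers are bounded and a limit
point of them is optimal (`isLeast_dualFunction_of_slater`).

*Converse.* Compare the joint law of message and output with the product of the uniform law and the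
product of the output marginals `q₁ ⊗ ⋯ ⊗ q_N`. Their relative entropy is exactly `∑ₙ I(Xₙ;Yₙ)`
(`BlockCode.sum_mutualInfo_letterDist`). Under the second law the decoder is right with probability
`1 / M`, so the Donsker–Varadhan inequality, tested on `log M` times the indicator of correct
decoding, yields Fano's bound `(1 - Pₑ) log M ≤ ∑ₙ I(Xₙ;Yₙ) + log 2` directly
(`BlockCode.one_sub_errorProb_mul_log_le`). Weak duality for the letter distributions bounds the sum
by `N * L₁(λ)` for every `λ ≥ 0`.

*Achievability.* Feinstein's greedy construction (`exists_code_of_forall_lt`) chooses codewords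
among the sequences that satisfy the cost constraint, with output sets on which the information
density exceeds `N * γ`, where `R < γ < I(X;Y)`. A Chernoff bound (`exists_sum_prod_le_pow`) shows
that independent letters have both properties with probability tending to `1`. This needs a strict
cost constraint or an input supported on letters of cost at most `ρ₀`; a feasible input is of the
second kind or is perturbed into one of the first (`isAchievable_of_mem_feasibleInputs`).
-/

/-! ### Mutual information of a channel input -/

/-- The distribution of the channel output when the input has distribution `p`. -/
def outputDist {X Y : Type*} [Fintype X] (W : X → Y → ℝ) (p : X → ℝ) (y : Y) : ℝ :=
  ∑ x, p x * W x y

section Information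

variable {X Y : Type*} [Fintype X] [Fintype Y] {W : X → Y → ℝ}

theorem outputDist_mem_stdSimplex (hW : IsChannel W) {p : X → ℝ} (hp : p ∈ stdSimplex ℝ X) :
    outputDist W p ∈ stdSimplex ℝ Y := by
  refine ⟨fun y => Finset.sum_nonneg fun x _ => mul_nonneg (hp.1 x) ((hW x).1 y), ?_⟩
  simp only [outputDist]
  rw [Finset.sum_comm]
  simp_rw [← Finset.mul_sum, (hW _).2, mul_one]
  exact hp.2

theorem outputDist_pos (hW : IsChannel W) {p : X → ℝ} (hp : p ∈ stdSimplex ℝ X) {x : X} {y : Y}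
    (h : 0 < p x * W x y) : 0 < outputDist W p y :=
  h.trans_le <| Finset.single_le_sum (f := fun x => p x * W x y)
    (fun x _ => mul_nonneg (hp.1 x) ((hW x).1 y)) (Finset.mem_univ x)

theorem mutualInfo_eq_sum_log_div (hW : IsChannel W) {p : X → ℝ} :
    mutualInfo W p = ∑ x, p x * ∑ y, W x y * Real.log (W x y / outputDist W p y) := by
  simp only [mutualInfo, jointMutualInfo]
  refine Finset.sum_congr rfl fun x _ => ?_
  rw [Finset.mul_sum]
  refine Finset.sum_congr rfl fun y _ => ?_
  rw [← Finset.mul_sum, (hW x).2, mul_one, ← mul_assoc]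
  rcases eq_or_ne (p x) 0 with h | h
  · simp [h]
  · rw [mul_div_mul_left _ _ h]
    rfl

/-- `I(X;Y) = H(Y) - H(Y|X)`. -/
theorem mutualInfo_eq_entropy_sub (hW : IsChannel W) {p : X → ℝ} (hp : p ∈ stdSimplex ℝ X) :
    mutualInfo W p = ∑ y, Real.negMulLog (outputDist W p y)
      - ∑ x, p x * ∑ y, Real.negMulLog (W x y) := by
  have key : ∀ x y, p x * (W x y * Real.log (W x y / outputDist W p y)) =
      -(p x * W x y * Real.log (outputDist W p y)) - p x * Real.negMulLog (W x y) := by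
    intro x y
    rcases (mul_nonneg (hp.1 x) ((hW x).1 y)).eq_or_lt with h | h
    · rcases mul_eq_zero.1 h.symm with h | h <;> simp [h]
    · have hq := outputDist_pos hW hp h
      have hw : W x y ≠ 0 := by rintro h0; simp [h0] at h
      rw [Real.log_div hw hq.ne', Real.negMulLog]
      ring
  rw [mutualInfo_eq_sum_log_div hW]
  simp_rw [Finset.mul_sum, key, Finset.sum_sub_distrib]
  congr 1
  rw [Finset.sum_comm]
  refine Finset.sum_congr rfl fun y _ => ?_
  rw [Finset.sum_neg_distrib, ← Finset.sum_mul, Real.negMulLog, neg_mul]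
  rfl

theorem continuousOn_mutualInfo (hW : IsChannel W) :
    ContinuousOn (mutualInfo W) (stdSimplex ℝ X) := by
  refine ContinuousOn.congr (Continuous.continuousOn ?_)
    fun p hp => mutualInfo_eq_entropy_sub hW hp
  unfold outputDist
  fun_prop

theorem concaveOn_mutualInfo (hW : IsChannel W) :
    ConcaveOn ℝ (stdSimplex ℝ X) (mutualInfo W) := by
  refine ⟨convex_stdSimplex ℝ X, fun p hp p' hp' a b ha hb hab => ?_⟩
  rw [mutualInfo_eq_entropy_sub hW hp, mutualInfo_eq_entropy_sub hW hp',
    mutualInfo_eq_entropy_sub hW (convex_stdSimplex ℝ X hp hp' ha hb hab)]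
  have h1 : ∀ y, a * Real.negMulLog (outputDist W p y) + b * Real.negMulLog (outputDist W p' y) ≤
      Real.negMulLog (outputDist W (a • p + b • p') y) := by
    intro y
    have h := Real.concaveOn_negMulLog.2 ((outputDist_mem_stdSimplex hW hp).1 y)
      ((outputDist_mem_stdSimplex hW hp').1 y) ha hb hab
    have e : outputDist W (a • p + b • p') y = a * outputDist W p y + b * outputDist W p' y := by
      simp only [outputDist, Finset.mul_sum, ← Finset.sum_add_distrib]
      exact Finset.sum_congr rfl fun x _ => by simp; ring
    rw [e]
    exact h
  have h2 := Finset.sum_le_sum fun y (_ : y ∈ Finset.univ) => h1 y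
  rw [Finset.sum_add_distrib, ← Finset.mul_sum, ← Finset.mul_sum] at h2
  have h3 : ∑ x, (a • p + b • p') x * ∑ y, Real.negMulLog (W x y) =
      a * ∑ x, p x * ∑ y, Real.negMulLog (W x y) +
      b * ∑ x, p' x * ∑ y, Real.negMulLog (W x y) := by
    simp only [Finset.mul_sum (s := Finset.univ) (a := a),
      Finset.mul_sum (s := Finset.univ) (a := b), ← Finset.sum_add_distrib]
    exact Finset.sum_congr rfl fun x _ => by simp; ring
  rw [h3]
  simp only [smul_eq_mul]
  linarith

end Information

section Cost

variable {X : Type*} [Fintype X]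

theorem expectedCost_add_smul (α : X → ℝ) (p p' : X → ℝ) (a b : ℝ) :
    expectedCost α (a • p + b • p') = a * expectedCost α p + b * expectedCost α p' := by
  simp only [expectedCost, Finset.mul_sum, ← Finset.sum_add_distrib]
  exact Finset.sum_congr rfl fun x _ => by simp; ring

theorem continuous_expectedCost (α : X → ℝ) : Continuous (expectedCost α) := by
  unfold expectedCost
  fun_prop

theorem exists_mem_stdSimplex_expectedCost_eq (α : X → ℝ) (x : X) :
    ∃ p ∈ stdSimplex ℝ X, expectedCost α p = α x := by
  classical
  exact ⟨Pi.single x 1, single_mem_stdSimplex ℝ x, by simp [expectedCost, Pi.single_apply]⟩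

theorem expectedCost_le_of_forall_le {α : X → ℝ} {ρ : ℝ} (h : ∀ x, α x ≤ ρ) {p : X → ℝ}
    (hp : p ∈ stdSimplex ℝ X) : expectedCost α p ≤ ρ := by
  calc expectedCost α p ≤ ∑ x, p x * ρ :=
        Finset.sum_le_sum fun x _ => mul_le_mul_of_nonneg_left (h x) (hp.1 x)
    _ = ρ := by rw [← Finset.sum_mul, hp.2, one_mul]

theorem isCompact_feasibleInputs (α : X → ℝ) (ρ : ℝ) : IsCompact (feasibleInputs α ρ) :=
  (isCompact_stdSimplex ℝ X).inter_right
    (isClosed_le (continuous_expectedCost α) continuous_const)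

end Cost

/-! ### Lagrange duality -/

section Duality

variable {X Y : Type*} [Fintype X] [Fintype Y] {W : X → Y → ℝ}

theorem continuousOn_lagrangian (hW : IsChannel W) (α : X → ℝ) (lam ρ : ℝ) :
    ContinuousOn (lagrangian W α lam ρ) (stdSimplex ℝ X) := by
  have := continuousOn_mutualInfo hW
  have h2 := (continuous_expectedCost α).continuousOn (s := stdSimplex ℝ X)
  unfold lagrangian
  fun_prop

theorem concaveOn_lagrangian (hW : IsChannel W) (α : X → ℝ) (lam ρ : ℝ) :
    ConcaveOn ℝ (stdSimplex ℝ X) (lagrangian W α lam ρ) := by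
  refine ⟨convex_stdSimplex ℝ X, fun p hp p' hp' a b ha hb hab => ?_⟩
  have h := (concaveOn_mutualInfo hW).2 hp hp' ha hb hab
  simp only [lagrangian, expectedCost_add_smul, smul_eq_mul] at h ⊢
  have : a * lam * ρ + b * lam * ρ = lam * ρ := by rw [← add_mul, ← add_mul, hab, one_mul]
  nlinarith

theorem isGreatest_dualFunction [Nonempty X] (hW : IsChannel W) (α : X → ℝ) (lam ρ : ℝ) :
    IsGreatest (lagrangian W α lam ρ '' stdSimplex ℝ X) (dualFunction W α lam ρ) := by
  classical
  refine ((isCompact_stdSimplex ℝ X).image_of_continuousOn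
    (continuousOn_lagrangian hW α lam ρ)).isGreatest_sSup ?_
  exact Set.Nonempty.image _ ⟨_, single_mem_stdSimplex ℝ (Classical.arbitrary X)⟩

/-- Weak duality. -/
theorem mutualInfo_le_dualFunction [Nonempty X] (hW : IsChannel W) (α : X → ℝ) {lam ρ : ℝ}
    (hlam : 0 ≤ lam) {p : X → ℝ} (hp : p ∈ feasibleInputs α ρ) :
    mutualInfo W p ≤ dualFunction W α lam ρ := by
  have h := (isGreatest_dualFunction hW α lam ρ).2 ⟨p, hp.1, rfl⟩
  have h2 := mul_nonneg hlam (sub_nonneg.2 hp.2)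
  simp only [lagrangian] at h
  linarith

theorem sum_mutualInfo_le_sum_lagrangian {α : X → ℝ} {lam ρ : ℝ} (hlam : 0 ≤ lam) {N : ℕ}
    {p : Fin N → X → ℝ} (hcost : (1 / (N : ℝ)) * ∑ n, expectedCost α (p n) ≤ ρ) :
    ∑ n, mutualInfo W (p n) ≤
      ∑ n, (mutualInfo W (p n) - lam * (expectedCost α (p n) - ρ)) := by
  rcases N.eq_zero_or_pos with rfl | hN
  · simp
  · have hN' : (0 : ℝ) < N := by exact_mod_cast hN
    rw [one_div, inv_mul_le_iff₀ hN'] at hcost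
    rw [Finset.sum_sub_distrib, ← Finset.mul_sum, Finset.sum_sub_distrib]
    simp only [Finset.sum_const, Finset.card_univ, Fintype.card_fin, nsmul_eq_mul]
    nlinarith [mul_nonneg hlam (sub_nonneg.2 hcost)]

theorem sum_lagrangian_le_mul_dualFunction [Nonempty X] (hW : IsChannel W) (α : X → ℝ)
    (lam ρ : ℝ) {N : ℕ} {p : Fin N → X → ℝ} (hp : ∀ n, p n ∈ stdSimplex ℝ X) :
    ∑ n, (mutualInfo W (p n) - lam * (expectedCost α (p n) - ρ)) ≤
      N * dualFunction W α lam ρ := by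
  calc _ ≤ ∑ _n : Fin N, dualFunction W α lam ρ :=
        Finset.sum_le_sum fun n _ => (isGreatest_dualFunction hW α lam ρ).2 ⟨p n, hp n, rfl⟩
    _ = _ := by simp

/-- An input of mutual information at least `K` violates the cost constraint, so that some
multiplier brings its Lagrangian below `K`; compactness of the simplex leaves finitely many
multipliers, which the minimax theorem replaces by a single one. No constraint qualification is
needed, because the bound is strict. -/
theorem exists_dualFunction_lt [Nonempty X] (hW : IsChannel W) (α : X → ℝ) {ρ K : ℝ}
    (hK : ∀ p ∈ feasibleInputs α ρ, mutualInfo W p < K) :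
    ∃ lam : ℝ, 0 ≤ lam ∧ dualFunction W α lam ρ < K := by
  classical
  have hpt : ∀ p ∈ stdSimplex ℝ X, ∃ lam : ℝ, 0 ≤ lam ∧ lagrangian W α lam ρ p < K := by
    intro p hp
    by_cases hc : expectedCost α p ≤ ρ
    · exact ⟨0, le_rfl, by simpa [lagrangian] using hK p ⟨hp, hc⟩⟩
    · have hd : 0 < expectedCost α p - ρ := by linarith
      obtain ⟨n, hn⟩ := exists_nat_gt ((mutualInfo W p - K) / (expectedCost α p - ρ))
      rw [div_lt_iff₀ hd] at hn
      exact ⟨n, n.cast_nonneg, by simp only [lagrangian]; linarith⟩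
  choose! l hl0 hl using hpt
  -- Each multiplier works on a neighbourhood, within the simplex, of the input it is chosen for.
  obtain ⟨t, ht, hcov⟩ := (isCompact_stdSimplex ℝ X).elim_nhdsWithin_subcover
    (fun p => {p' | lagrangian W α (l p) ρ p' < K})
    (fun p hp => (continuousOn_lagrangian hW α (l p) ρ p hp).eventually_lt_const (hl p hp))
  obtain ⟨lam, hlam, h⟩ := Sion.exists_lt_iInf_of_lt_iInf_of_finite
    (X := stdSimplex ℝ X) (Y := Set.Ici (0 : ℝ)) (f := fun p lam => -lagrangian W α lam ρ p)
    ⟨_, single_mem_stdSimplex ℝ (Classical.arbitrary X)⟩ (isCompact_stdSimplex ℝ X)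
    (fun lam _ => (continuousOn_lagrangian hW α lam ρ).neg.lowerSemicontinuousOn)
    (fun lam _ => (concaveOn_lagrangian hW α lam ρ).neg.quasiconvexOn)
    (convex_Ici 0)
    (fun p _ => Continuous.upperSemicontinuous (by unfold lagrangian; fun_prop)
      |>.upperSemicontinuousOn _)
    (fun p _ => by
      refine ConcaveOn.quasiconcaveOn ⟨convex_Ici 0, fun x _ y _ a b _ _ hab => le_of_eq ?_⟩
      simp only [lagrangian, smul_eq_mul]
      linear_combination (-mutualInfo W p) * hab)
    (convex_stdSimplex ℝ X) (s := l '' t) (t.finite_toSet.image l)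
    (by rintro _ ⟨p, hp, rfl⟩; exact hl0 p (ht p hp))
    (t := -K) (by
      intro p hp
      obtain ⟨p', hp', h⟩ := Set.mem_iUnion₂.1 (hcov hp)
      exact ⟨l p', ⟨p', hp', rfl⟩, neg_lt_neg h⟩)
  obtain ⟨p, hp, hpe⟩ := (isGreatest_dualFunction hW α lam ρ).1
  exact ⟨lam, hlam, by simpa [← hpe] using h p hp⟩

/-- Strong duality. -/
theorem isGLB_dualFunction [Nonempty X] (hW : IsChannel W) {α : X → ℝ} {ρ C : ℝ}
    (hC : IsGreatest (mutualInfo W '' feasibleInputs α ρ) C) :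
    IsGLB ((fun lam => dualFunction W α lam ρ) '' Set.Ici 0) C := by
  obtain ⟨⟨p, hp, rfl⟩, hmax⟩ := hC
  refine ⟨?_, fun b hb => le_of_forall_gt fun K hK => ?_⟩
  · rintro _ ⟨lam, hlam, rfl⟩
    exact mutualInfo_le_dualFunction hW α hlam hp
  · obtain ⟨lam, hlam, h⟩ := exists_dualFunction_lt hW α (ρ := ρ) (K := K)
      fun p' hp' => (hmax ⟨p', hp', rfl⟩).trans_lt hK
    exact (hb ⟨lam, hlam, rfl⟩).trans_lt h

/-- Under Slater's condition the multipliers that are optimal up to `1` are bounded, so a minimizing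
sequence of multipliers has a convergent subsequence. -/
theorem isLeast_dualFunction_of_slater [Nonempty X] (hW : IsChannel W) {α : X → ℝ} {ρ C : ℝ}
    (hC : IsGLB ((fun lam => dualFunction W α lam ρ) '' Set.Ici 0) C) (hx : ∃ x, α x < ρ) :
    IsLeast ((fun lam => dualFunction W α lam ρ) '' Set.Ici 0) C := by
  obtain ⟨x, hx⟩ := hx
  obtain ⟨p₀, hp₀, hcost⟩ := exists_mem_stdSimplex_expectedCost_eq α x
  have hseq : ∀ n : ℕ, ∃ lam : ℝ, 0 ≤ lam ∧ dualFunction W α lam ρ < C + 1 / ((n : ℝ) + 1) := by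
    intro n
    obtain ⟨_, ⟨lam, hlam, rfl⟩, h⟩ := (isGLB_lt_iff hC).1
      (show C < C + 1 / ((n : ℝ) + 1) from lt_add_of_pos_right _ Nat.one_div_pos_of_nat)
    exact ⟨lam, hlam, h⟩
  choose l hl0 hl using hseq
  have hle : ∀ n, ∀ p ∈ stdSimplex ℝ X, lagrangian W α (l n) ρ p ≤ C + 1 / ((n : ℝ) + 1) :=
    fun n p hp => ((isGreatest_dualFunction hW α (l n) ρ).2 ⟨p, hp, rfl⟩).trans (hl n).le
  have hbdd : ∀ n, l n ∈ Set.Icc 0 ((C + 1 - mutualInfo W p₀) / (ρ - α x)) := by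
    refine fun n => ⟨hl0 n, ?_⟩
    rw [le_div_iff₀ (sub_pos.2 hx)]
    have h1 := hle n p₀ hp₀
    have h2 : 1 / ((n : ℝ) + 1) ≤ 1 := by
      rw [div_le_one (by positivity)]
      linarith [n.cast_nonneg (α := ℝ)]
    simp only [lagrangian, hcost] at h1
    linarith
  obtain ⟨lam, hlam, φ, hφ, hlim⟩ := isCompact_Icc.tendsto_subseq hbdd
  have hgoal : dualFunction W α lam ρ ≤ C := by
    obtain ⟨p, hp, hpe⟩ := (isGreatest_dualFunction hW α lam ρ).1
    rw [← hpe]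
    have hcont : Continuous fun s => lagrangian W α s ρ p := by
      unfold lagrangian
      fun_prop
    refine le_of_tendsto_of_tendsto' ((hcont.tendsto lam).comp hlim)
      (?_ : Tendsto (fun k => C + 1 / ((φ k : ℝ) + 1)) atTop (nhds C)) fun k => hle (φ k) p hp
    simpa using (tendsto_const_nhds (x := C)).add
      (tendsto_one_div_add_atTop_nhds_zero_nat.comp hφ.tendsto_atTop)
  exact ⟨⟨lam, hlam.1, hgoal.antisymm (hC.1 ⟨lam, hlam.1, rfl⟩)⟩, hC.1⟩

/-- When every letter satisfies the constraint, the multiplier `0` is optimal. -/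
theorem isLeast_dualFunction_of_forall_le [Nonempty X] (hW : IsChannel W) {α : X → ℝ} {ρ C : ℝ}
    (hC : IsGreatest (mutualInfo W '' feasibleInputs α ρ) C) (hα : ∀ x, α x ≤ ρ) :
    IsLeast ((fun lam => dualFunction W α lam ρ) '' Set.Ici 0) C := by
  have hglb := isGLB_dualFunction hW hC
  refine ⟨⟨0, Set.self_mem_Ici, le_antisymm ?_ (hglb.1 ⟨0, Set.self_mem_Ici, rfl⟩)⟩, hglb.1⟩
  obtain ⟨p, hp, hpe⟩ := (isGreatest_dualFunction hW α 0 ρ).1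
  refine hpe.symm.trans_le (hC.2 ⟨p, ⟨hp, expectedCost_le_of_forall_le hα hp⟩, ?_⟩)
  simp [lagrangian]

end Duality

/-! ### The converse -/

/-- A product of probability vectors, integrated against a function of the coordinate `n`. -/
theorem sum_prod_mul_apply {Y : Type*} [Fintype Y] {N : ℕ} {w : Fin N → Y → ℝ}
    (hw : ∀ k, ∑ b, w k b = 1) (n : Fin N) (g : Y → ℝ) :
    ∑ y : Fin N → Y, (∏ k, w k (y k)) * g (y n) = ∑ b, w n b * g b := by
  classical
  have h : ∀ y : Fin N → Y, (∏ k, w k (y k)) * g (y n) =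
      ∏ k, w k (y k) * (if k = n then g (y k) else 1) := by
    intro y
    rw [Finset.prod_mul_distrib]
    simp
  simp_rw [h]
  rw [← Fintype.prod_sum (fun k b => w k b * (if k = n then g b else 1)),
    Finset.prod_eq_single n]
  · simp
  · intro k _ hk
    simp [hk, hw]
  · simp

theorem sum_prod_eq_one {Y : Type*} [Fintype Y] {N : ℕ} {w : Fin N → Y → ℝ}
    (hw : ∀ k, ∑ b, w k b = 1) : ∑ y : Fin N → Y, ∏ k, w k (y k) = 1 := by
  classical
  rw [← Fintype.prod_sum (fun k b => w k b)]
  simp [hw]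

/-- The distribution of the `n`-th channel input of a code when the message is uniform. It is a
probability vector only if there is at least one message. -/
noncomputable def BlockCode.letterDist {X Y : Type*} {M N : ℕ} (c : BlockCode X Y M N)
    (n : Fin N) (x : X) : ℝ :=
  open scoped Classical in (1 / (M : ℝ)) * ∑ m, if c.enc m n = x then 1 else 0

section Converse

theorem BlockCode.sum_letterDist_mul {X Y : Type*} [Fintype X] {M N : ℕ}
    (c : BlockCode X Y M N) (n : Fin N) (g : X → ℝ) :
    ∑ x, c.letterDist n x * g x = (1 / (M : ℝ)) * ∑ m, g (c.enc m n) := by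
  classical
  simp only [BlockCode.letterDist, mul_assoc, ← Finset.mul_sum, Finset.sum_mul]
  rw [Finset.sum_comm]
  simp

theorem BlockCode.letterDist_mem_stdSimplex {X Y : Type*} [Fintype X] {M N : ℕ}
    (c : BlockCode X Y M N) (hM : 0 < M) (n : Fin N) :
    c.letterDist n ∈ stdSimplex ℝ X := by
  classical
  have hM' : (M : ℝ) ≠ 0 := by exact_mod_cast hM.ne'
  refine ⟨fun x => ?_, ?_⟩
  · unfold BlockCode.letterDist
    exact mul_nonneg (by positivity) (Finset.sum_nonneg fun m _ => by split_ifs <;> simp)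
  · simpa [hM'] using c.sum_letterDist_mul n fun _ => 1

theorem BlockCode.averageCost_eq {X Y : Type*} [Fintype X] {M N : ℕ}
    (c : BlockCode X Y M N) (α : X → ℝ) :
    c.averageCost α = (1 / (N : ℝ)) * ∑ n, expectedCost α (c.letterDist n) := by
  simp only [BlockCode.averageCost, expectedCost, c.sum_letterDist_mul]

/-- The inequality `log t ≤ t - 1` at `t = r * exp a / (2 * v)`: the pointwise form of the
Donsker–Varadhan lower bound for a relative entropy. -/
theorem mul_le_mul_log_div_add {v r a : ℝ} (hv : 0 ≤ v) (hr : 0 ≤ r) (h : 0 < v → 0 < r) :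
    v * a ≤ v * (Real.log (v / r) + Real.log 2) + (r * Real.exp a / 2 - v) := by
  rcases hv.eq_or_lt with rfl | hv
  · simp only [zero_mul, zero_add, sub_zero]
    positivity
  · have hr := h hv
    have h1 := Real.log_le_sub_one_of_pos (show 0 < r * Real.exp a / (2 * v) by positivity)
    rw [Real.log_div (by positivity) (by positivity), Real.log_mul hr.ne' (Real.exp_ne_zero a),
      Real.log_exp, Real.log_mul two_ne_zero hv.ne'] at h1
    rw [Real.log_div hv.ne' hr.ne']
    have h2 := mul_le_mul_of_nonneg_left h1 hv.le
    have h3 : v * (r * Real.exp a / (2 * v) - 1) = r * Real.exp a / 2 - v := by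
      field_simp
    rw [h3] at h2
    linarith

variable {X Y : Type*} [Fintype X] [Fintype Y] {W : X → Y → ℝ} {M N : ℕ}

theorem BlockCode.outputDist_letterDist_pos (c : BlockCode X Y M N) (hW : IsChannel W)
    (hM : 0 < M) {m : Fin M} {n : Fin N} {b : Y} (h : 0 < W (c.enc m n) b) :
    0 < outputDist W (c.letterDist n) b := by
  classical
  refine outputDist_pos hW (c.letterDist_mem_stdSimplex hM n) (mul_pos ?_ h)
  have hM' : (0 : ℝ) < M := by exact_mod_cast hM
  unfold BlockCode.letterDist
  refine mul_pos (by positivity) (Finset.sum_pos' (fun m _ => ?_) ⟨m, Finset.mem_univ m, ?_⟩)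
  · split_ifs <;> simp
  · simp

/-- The mutual informations of the single letters add up to the relative entropy between the joint
distribution of message and output and the product of the uniform distribution with the product of
the output marginals. -/
theorem BlockCode.sum_mutualInfo_letterDist (c : BlockCode X Y M N) (hW : IsChannel W)
    (hM : 0 < M) :
    ∑ n, mutualInfo W (c.letterDist n) = (1 / (M : ℝ)) * ∑ m, ∑ y : Fin N → Y,
      (∏ n, W (c.enc m n) (y n)) * Real.log ((∏ n, W (c.enc m n) (y n)) /
        ∏ n, outputDist W (c.letterDist n) (y n)) := by
  have h1 : ∀ n, mutualInfo W (c.letterDist n) = (1 / (M : ℝ)) * ∑ m, ∑ y : Fin N → Y,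
      (∏ k, W (c.enc m k) (y k)) * Real.log (W (c.enc m n) (y n) /
        outputDist W (c.letterDist n) (y n)) := by
    intro n
    rw [mutualInfo_eq_sum_log_div hW, c.sum_letterDist_mul]
    congr 1
    refine Finset.sum_congr rfl fun m _ => ?_
    exact (sum_prod_mul_apply (fun k => (hW (c.enc m k)).2) n fun b =>
      Real.log (W (c.enc m n) b / outputDist W (c.letterDist n) b)).symm
  simp_rw [h1]
  rw [← Finset.mul_sum, Finset.sum_comm]
  congr 1
  refine Finset.sum_congr rfl fun m _ => ?_
  rw [Finset.sum_comm]
  refine Finset.sum_congr rfl fun y _ => ?_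
  rw [← Finset.mul_sum]
  rcases eq_or_ne (∏ k, W (c.enc m k) (y k)) 0 with h | h
  · simp [h]
  · rw [← Finset.prod_div_distrib, Real.log_prod]
    intro n _
    have hw : W (c.enc m n) (y n) ≠ 0 := fun h0 =>
      h (Finset.prod_eq_zero (Finset.mem_univ n) h0)
    exact div_ne_zero hw (c.outputDist_letterDist_pos hW hM
      (((hW _).1 _).lt_of_ne' hw)).ne'

/-- Fano's inequality for a memoryless channel. -/
theorem BlockCode.one_sub_errorProb_mul_log_le (c : BlockCode X Y M N) (hW : IsChannel W)
    (hM : 0 < M) :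
    (1 - c.errorProb W) * Real.log M ≤ ∑ n, mutualInfo W (c.letterDist n) + Real.log 2 := by
  classical
  have hM' : (0 : ℝ) < M := by exact_mod_cast hM
  set V : Fin M → (Fin N → Y) → ℝ := fun m y => ∏ n, W (c.enc m n) (y n) with hV
  set r : (Fin N → Y) → ℝ := fun y => ∏ n, outputDist W (c.letterDist n) (y n) with hr
  set a : Fin M → (Fin N → Y) → ℝ := fun m y => if c.dec y = m then Real.log M else 0 with ha
  have hout := fun n => outputDist_mem_stdSimplex hW (c.letterDist_mem_stdSimplex hM n)
  have hV0 : ∀ m y, 0 ≤ V m y := fun m y => Finset.prod_nonneg fun n _ => (hW _).1 _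
  have hr0 : ∀ y, 0 ≤ r y := fun y => Finset.prod_nonneg fun n _ => (hout n).1 _
  have hV1 : ∀ m, ∑ y, V m y = 1 := fun m => sum_prod_eq_one fun k => (hW _).2
  have hr1 : ∑ y, r y = 1 := sum_prod_eq_one fun k => (hout k).2
  have hpos : ∀ m y, 0 < V m y → 0 < r y := by
    intro m y h
    refine Finset.prod_pos fun n _ => c.outputDist_letterDist_pos hW hM (m := m) ?_
    exact ((hW _).1 _).lt_of_ne' fun h0 => h.ne' (Finset.prod_eq_zero (Finset.mem_univ n) h0)
  have hmain : ∑ m, ∑ y, V m y * a m y ≤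
      ∑ m, ∑ y, (V m y * Real.log (V m y / r y) + V m y * Real.log 2
        + (r y * Real.exp (a m y) / 2 - V m y)) := by
    refine Finset.sum_le_sum fun m _ => Finset.sum_le_sum fun y _ => ?_
    rw [← mul_add]
    exact mul_le_mul_log_div_add (hV0 m y) (hr0 y) (hpos m y)
  simp only [Finset.sum_add_distrib, Finset.sum_sub_distrib, ← Finset.sum_mul, hV1] at hmain
  -- Under the product distribution the decoder is right with probability `1 / M`.
  have hexp : ∑ m, ∑ y, r y * Real.exp (a m y) / 2 ≤ M := by
    have h : ∀ y, ∑ m, r y * Real.exp (a m y) / 2 ≤ r y * M := by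
      intro y
      have h2 : ∑ m, Real.exp (a m y) ≤ 2 * M := by
        calc ∑ m, Real.exp (a m y) ≤ ∑ m, ((if c.dec y = m then (M : ℝ) else 0) + 1) := by
              refine Finset.sum_le_sum fun m _ => ?_
              simp only [ha]
              split_ifs
              · rw [Real.exp_log hM']; linarith
              · simp
          _ = 2 * M := by simp [Finset.sum_add_distrib]; ring
      rw [← Finset.sum_div, ← Finset.mul_sum]
      nlinarith [hr0 y]
    rw [Finset.sum_comm]
    calc _ ≤ ∑ y, r y * M := Finset.sum_le_sum fun y _ => h y
      _ = M := by rw [← Finset.sum_mul, hr1, one_mul]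
  have herr : ∑ m, ∑ y, V m y * a m y = M * ((1 - c.errorProb W) * Real.log M) := by
    have h : ∀ m, ∑ y, V m y * a m y =
        (1 - ∑ y with c.dec y ≠ m, V m y) * Real.log M := by
      intro m
      rw [← hV1 m, ← Finset.sum_filter_add_sum_filter_not _ (fun y => c.dec y = m) (V m),
        add_sub_cancel_right, Finset.sum_mul, Finset.sum_filter]
      refine Finset.sum_congr rfl fun y _ => ?_
      simp only [ha]
      split_ifs <;> simp
    simp_rw [h]
    rw [← Finset.sum_mul, Finset.sum_sub_distrib]
    simp only [BlockCode.errorProb, Finset.sum_const, Finset.card_univ, Fintype.card_fin,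
      nsmul_eq_mul, mul_one]
    field_simp
    rw [mul_comm]
  rw [herr] at hmain
  simp only [Finset.sum_const, Finset.card_univ, Fintype.card_fin, nsmul_eq_mul, mul_one] at hmain
  rw [c.sum_mutualInfo_letterDist hW hM, ← mul_le_mul_iff_right₀ hM', mul_add,
    ← mul_assoc (M : ℝ) (1 / (M : ℝ)),
    mul_one_div_cancel hM'.ne', one_mul]
  change _ ≤ ∑ m, ∑ y, V m y * Real.log (V m y / r y) + _
  linarith

/-- The weak converse: no achievable rate exceeds the optimal value of the dual problem. -/
theorem le_of_isAchievable [Nonempty X] (hW : IsChannel W) {α : X → ℝ} {ρ C R : ℝ}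
    (hC : IsGLB ((fun lam => dualFunction W α lam ρ) '' Set.Ici 0) C)
    (hR : IsAchievable W α ρ R) : R ≤ C := by
  have hε : ∀ ε : ℝ, 0 < ε → ε < 1 → (1 - ε) * R ≤ C := by
    intro ε hε hε1
    have hev : ∀ᶠ N : ℕ in atTop, (1 - ε) * R ≤ C + Real.log 2 / N := by
      filter_upwards [hR ε hε, eventually_gt_atTop 0] with N ⟨c, hcost, herr⟩ hN
      have hN' : (0 : ℝ) < N := by exact_mod_cast hN
      have hM : 0 < ⌈Real.exp ((N : ℝ) * R)⌉₊ := Nat.ceil_pos.2 (Real.exp_pos _)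
      have hM1 : (1 : ℝ) ≤ (⌈Real.exp ((N : ℝ) * R)⌉₊ : ℝ) := by exact_mod_cast hM
      have hlog : (N : ℝ) * R ≤ Real.log ⌈Real.exp ((N : ℝ) * R)⌉₊ := by
        rw [Real.le_log_iff_exp_le (by linarith)]
        exact Nat.le_ceil _
      have h1 := c.one_sub_errorProb_mul_log_le hW hM
      have h2 : (∑ n, mutualInfo W (c.letterDist n)) / N ≤ C := by
        refine (le_isGLB_iff hC).2 ?_
        rintro _ ⟨lam, hlam, rfl⟩
        rw [div_le_iff₀' hN']
        rw [c.averageCost_eq] at hcost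
        exact (sum_mutualInfo_le_sum_lagrangian hlam hcost).trans
          (sum_lagrangian_le_mul_dualFunction hW α lam ρ (c.letterDist_mem_stdSimplex hM))
      rw [div_le_iff₀ hN'] at h2
      have h3 : (1 - ε) * ((N : ℝ) * R) ≤
          (1 - c.errorProb W) * Real.log ⌈Real.exp ((N : ℝ) * R)⌉₊ :=
        (mul_le_mul_of_nonneg_left hlog (by linarith)).trans
          (mul_le_mul_of_nonneg_right (by linarith) (Real.log_nonneg hM1))
      rw [← mul_le_mul_iff_left₀ hN', add_mul, div_mul_cancel₀ _ hN'.ne']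
      linarith
    refine ge_of_tendsto (?_ : Tendsto (fun N : ℕ => C + Real.log 2 / (N : ℝ)) atTop (nhds C)) hev
    simpa using (tendsto_const_nhds (x := C)).add
      (tendsto_const_div_atTop_nhds_zero_nat (Real.log 2))
  have hlim : Tendsto (fun ε : ℝ => (1 - ε) * R) (nhdsWithin 0 (Set.Ioi 0)) (nhds R) := by
    have h : Continuous fun ε : ℝ => (1 - ε) * R := by fun_prop
    simpa using (h.tendsto 0).mono_left nhdsWithin_le_nhds
  refine le_of_tendsto hlim ?_
  filter_upwards [Ioo_mem_nhdsGT (zero_lt_one (α := ℝ))] with ε h using hε ε h.1 h.2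

end Converse

/-! ### Achievability -/

/-- A Chernoff bound: for independent letters of distribution `w`, the sum of `f` exceeds a level
above its mean with exponentially small probability. -/
theorem exists_sum_prod_le_pow {Z : Type*} [Fintype Z] {w f : Z → ℝ} (hw : w ∈ stdSimplex ℝ Z)
    {γ : ℝ} (h : ∑ z, w z * f z < γ) :
    ∃ r : ℝ, 0 ≤ r ∧ r < 1 ∧ ∀ N : ℕ,
      ∑ z : Fin N → Z with N * γ ≤ ∑ n, f (z n), ∏ n, w (z n) ≤ r ^ N := by
  classical
  let g : ℝ → ℝ := fun s => ∑ z, w z * Real.exp (s * (f z - γ))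
  have hg0 : g 0 = 1 := by simpa [g] using hw.2
  have hder : HasDerivAt g (∑ z, w z * (f z - γ)) 0 := by
    refine HasDerivAt.fun_sum fun z _ => HasDerivAt.const_mul _ ?_
    have h1 := ((hasDerivAt_id (0 : ℝ)).mul_const (f z - γ)).exp
    simpa using h1
  have hneg : ∑ z, w z * (f z - γ) < 0 := by
    simp_rw [mul_sub]
    rw [Finset.sum_sub_distrib, ← Finset.sum_mul, hw.2]
    linarith
  obtain ⟨s, hs0, hs⟩ : ∃ s : ℝ, 0 < s ∧ g s < 1 := by
    have hev : ∀ᶠ s in nhdsWithin (0 : ℝ) (Set.Ioi 0), slope g 0 s < 0 :=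
      ((hasDerivAt_iff_tendsto_slope.1 hder).mono_left
        (nhdsWithin_mono 0 fun s hs => (ne_of_gt hs : s ≠ 0))).eventually_lt_const hneg
    obtain ⟨s, hs, hs0⟩ := (hev.and self_mem_nhdsWithin).exists
    refine ⟨s, hs0, ?_⟩
    have hs0' : (0 : ℝ) < s := hs0
    rw [slope_def_field, hg0, sub_zero, div_lt_iff₀ hs0', zero_mul] at hs
    linarith
  refine ⟨g s, Finset.sum_nonneg fun z _ => mul_nonneg (hw.1 z) (Real.exp_pos _).le, hs,
    fun N => ?_⟩
  calc ∑ z : Fin N → Z with N * γ ≤ ∑ n, f (z n), ∏ n, w (z n)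
      ≤ ∑ z : Fin N → Z with N * γ ≤ ∑ n, f (z n),
          ∏ n, w (z n) * Real.exp (s * (f (z n) - γ)) := by
        refine Finset.sum_le_sum fun z hz => ?_
        rw [Finset.prod_mul_distrib, ← Real.exp_sum, ← Finset.mul_sum, Finset.sum_sub_distrib]
        refine le_mul_of_one_le_right (Finset.prod_nonneg fun n _ => hw.1 _) ?_
        rw [Real.one_le_exp_iff]
        have := (Finset.mem_filter.1 hz).2
        refine mul_nonneg hs0.le ?_
        simpa using this
    _ ≤ ∑ z : Fin N → Z, ∏ n, w (z n) * Real.exp (s * (f (z n) - γ)) :=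
        Finset.sum_le_univ_sum_of_nonneg fun z =>
          Finset.prod_nonneg fun n _ => mul_nonneg (hw.1 _) (Real.exp_pos _).le
    _ = g s ^ N := by
        rw [← Fintype.prod_sum (fun (_ : Fin N) z => w z * Real.exp (s * (f z - γ)))]
        simp [g]

/-- Feinstein's maximal code lemma. The codewords are chosen greedily: as long as `k < M` of them
have been chosen, their decoding sets cover output probability at most `k * κ`, so that some
admissible input `a` still sends more than `1 - ε` into the uncovered part of `T a`. -/
theorem exists_code_of_forall_lt {A B : Type*} [Fintype A] [Fintype B] {P : A → ℝ}
    {V : A → B → ℝ} {Q : B → ℝ} {S : Finset A} {T : A → Finset B} {κ ε : ℝ}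
    (hP : P ∈ stdSimplex ℝ A) (hV : ∀ a b, 0 ≤ V a b) (hQ : ∀ b, ∑ a, P a * V a b = Q b)
    (hT : ∀ a ∈ S, ∑ b ∈ T a, Q b ≤ κ) (hε : ε ≤ 1) {M : ℕ}
    (h : ∀ k < M, 1 - ε + k * κ < ∑ a ∈ S, P a * ∑ b ∈ T a, V a b) :
    ∃ (enc : Fin M → A) (D : Fin M → Finset B), (∀ m, enc m ∈ S) ∧
      (∀ m m', m ≠ m' → Disjoint (D m) (D m')) ∧ ∀ m, 1 - ε ≤ ∑ b ∈ D m, V (enc m) b := by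
  classical
  suffices H : ∃ (enc : Fin M → A) (D : Fin M → Finset B), (∀ m, enc m ∈ S) ∧
      (∀ m m', m ≠ m' → Disjoint (D m) (D m')) ∧ (∀ m, 1 - ε ≤ ∑ b ∈ D m, V (enc m) b) ∧
      ∀ m, D m ⊆ T (enc m) by
    obtain ⟨enc, D, h1, h2, h3, -⟩ := H
    exact ⟨enc, D, h1, h2, h3⟩
  induction M with
  | zero => exact ⟨Fin.elim0, Fin.elim0, fun m => m.elim0, fun m => m.elim0, fun m => m.elim0,
      fun m => m.elim0⟩
  | succ M ih =>
    obtain ⟨enc, D, hS, hdisj, hD, hDT⟩ := ih fun k hk => h k (hk.trans M.lt_succ_self)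
    have hQ0 : ∀ b, 0 ≤ Q b := fun b => by
      rw [← hQ]
      exact Finset.sum_nonneg fun a _ => mul_nonneg (hP.1 a) (hV a b)
    set U : Finset B := Finset.univ.biUnion D with hU
    have hQU : ∑ b ∈ U, Q b ≤ M * κ := by
      calc ∑ b ∈ U, Q b = ∑ m, ∑ b ∈ D m, Q b :=
            Finset.sum_biUnion fun m _ m' _ hne => hdisj m m' hne
        _ ≤ ∑ _m : Fin M, κ := Finset.sum_le_sum fun m _ =>
            (Finset.sum_le_sum_of_subset_of_nonneg (hDT m) fun b _ _ => hQ0 b).trans (hT _ (hS m))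
        _ = M * κ := by simp
    obtain ⟨a, haS, ha⟩ : ∃ a ∈ S, 1 - ε < ∑ b ∈ T a \ U, V a b := by
      by_contra! hcon
      have h1 : ∑ a ∈ S, P a * ∑ b ∈ T a \ U, V a b ≤ 1 - ε := by
        calc ∑ a ∈ S, P a * ∑ b ∈ T a \ U, V a b ≤ ∑ a ∈ S, P a * (1 - ε) :=
              Finset.sum_le_sum fun a ha => mul_le_mul_of_nonneg_left (hcon a ha) (hP.1 a)
          _ = (∑ a ∈ S, P a) * (1 - ε) := by rw [Finset.sum_mul]
          _ ≤ 1 * (1 - ε) := by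
              refine mul_le_mul_of_nonneg_right ?_ (by linarith)
              rw [← hP.2]
              exact Finset.sum_le_univ_sum_of_nonneg hP.1
          _ = 1 - ε := one_mul _
      have h2 : ∑ a ∈ S, P a * ∑ b ∈ U, V a b ≤ M * κ := by
        calc ∑ a ∈ S, P a * ∑ b ∈ U, V a b ≤ ∑ a, P a * ∑ b ∈ U, V a b :=
              Finset.sum_le_univ_sum_of_nonneg fun a =>
                mul_nonneg (hP.1 a) (Finset.sum_nonneg fun b _ => hV a b)
          _ = ∑ b ∈ U, Q b := by
              simp_rw [Finset.mul_sum]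
              rw [Finset.sum_comm]
              exact Finset.sum_congr rfl fun b _ => hQ b
          _ ≤ M * κ := hQU
      have h3 : ∑ a ∈ S, P a * ∑ b ∈ T a, V a b ≤
          ∑ a ∈ S, P a * ∑ b ∈ T a \ U, V a b + ∑ a ∈ S, P a * ∑ b ∈ U, V a b := by
        rw [← Finset.sum_add_distrib]
        refine Finset.sum_le_sum fun a _ => ?_
        rw [← mul_add]
        refine mul_le_mul_of_nonneg_left ?_ (hP.1 a)
        rw [← Finset.sum_inter_add_sum_sdiff (T a) U (V a), add_comm]
        gcongr
        · exact fun b _ _ => hV a b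
        · exact Finset.inter_subset_right
      have h4 := h M M.lt_succ_self
      linarith
    have hnew : ∀ m, Disjoint (D m) (T a \ U) := fun m =>
      Finset.disjoint_sdiff.mono_left (Finset.subset_biUnion_of_mem D (Finset.mem_univ m))
    refine ⟨Fin.snoc enc a, Fin.snoc D (T a \ U), ?_, ?_, ?_, ?_⟩
    · intro m
      induction m using Fin.lastCases <;> simp [haS, hS]
    · intro m m'
      induction m using Fin.lastCases with
      | last =>
        induction m' using Fin.lastCases with
        | last => simp
        | cast m' => simpa using fun _ => (hnew m').symm
      | cast m =>
        induction m' using Fin.lastCases with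
        | last => simpa using hnew m
        | cast m' => simpa using hdisj m m'
    · intro m
      induction m using Fin.lastCases with
      | last => simpa using ha.le
      | cast m => simpa using hD m
    · intro m
      induction m using Fin.lastCases with
      | last => simp
      | cast m => simpa using hDT m

/-- Disjoint decoding sets, each of probability at least `1 - ε` under its codeword, make a block
code of error probability at most `ε`. -/
theorem exists_blockCode_of_disjoint {X Y : Type*} [Fintype Y] {W : X → Y → ℝ} (hW : IsChannel W)
    {M N : ℕ} (hM : 0 < M) {ε : ℝ} (enc : Fin M → Fin N → X) (D : Fin M → Finset (Fin N → Y))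
    (hdisj : ∀ m m', m ≠ m' → Disjoint (D m) (D m'))
    (hD : ∀ m, 1 - ε ≤ ∑ y ∈ D m, ∏ n, W (enc m n) (y n)) :
    ∃ c : BlockCode X Y M N, c.enc = enc ∧ c.errorProb W ≤ ε := by
  classical
  have : Nonempty (Fin M) := ⟨⟨0, hM⟩⟩
  have hM' : (0 : ℝ) < M := by exact_mod_cast hM
  let dec : (Fin N → Y) → Fin M := fun y =>
    if h : ∃ m, y ∈ D m then h.choose else Classical.arbitrary _
  have hdec : ∀ m, ∀ y ∈ D m, dec y = m := by
    intro m y hy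
    have h : ∃ m, y ∈ D m := ⟨m, hy⟩
    simp only [dec, dif_pos h]
    by_contra hne
    exact Finset.disjoint_left.1 (hdisj _ _ hne) h.choose_spec hy
  refine ⟨⟨enc, dec⟩, rfl, ?_⟩
  have herr : ∀ m, ∑ y with dec y ≠ m, ∏ n, W (enc m n) (y n) ≤ ε := by
    intro m
    have h1 : ∑ y : Fin N → Y, ∏ n, W (enc m n) (y n) = 1 :=
      sum_prod_eq_one fun k => (hW (enc m k)).2
    have h2 := Finset.sum_sdiff (f := fun y : Fin N → Y => ∏ n, W (enc m n) (y n))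
      (Finset.subset_univ (D m))
    have h3 : ∑ y with dec y ≠ m, ∏ n, W (enc m n) (y n) ≤
        ∑ y ∈ Finset.univ \ D m, ∏ n, W (enc m n) (y n) := by
      refine Finset.sum_le_sum_of_subset_of_nonneg (fun y hy => ?_)
        fun y _ _ => Finset.prod_nonneg fun n _ => (hW _).1 _
      simp only [Finset.mem_filter, Finset.mem_univ, true_and, Finset.mem_sdiff] at hy ⊢
      exact fun h => hy (hdec m y h)
    linarith [hD m]
  calc BlockCode.errorProb ⟨enc, dec⟩ W ≤ (1 / (M : ℝ)) * ∑ _m : Fin M, ε :=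
        mul_le_mul_of_nonneg_left (Finset.sum_le_sum fun m _ => herr m) (by positivity)
    _ = ε := by
        simp only [Finset.sum_const, Finset.card_univ, Fintype.card_fin, nsmul_eq_mul]
        field_simp

section Achievability

variable {X Y : Type*} [Fintype X] [Fintype Y] {W : X → Y → ℝ}

theorem prod_mem_stdSimplex {p : X → ℝ} (hp : p ∈ stdSimplex ℝ X) (N : ℕ) :
    (fun x : Fin N → X => ∏ n, p (x n)) ∈ stdSimplex ℝ (Fin N → X) :=
  ⟨fun _ => Finset.prod_nonneg fun _ _ => hp.1 _, sum_prod_eq_one fun _ => hp.2⟩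

theorem joint_mem_stdSimplex (hW : IsChannel W) {p : X → ℝ} (hp : p ∈ stdSimplex ℝ X) :
    (fun z : X × Y => p z.1 * W z.1 z.2) ∈ stdSimplex ℝ (X × Y) := by
  refine ⟨fun z => mul_nonneg (hp.1 _) ((hW _).1 _), ?_⟩
  rw [Fintype.sum_prod_type]
  simp_rw [← Finset.mul_sum, (hW _).2, mul_one]
  exact hp.2

/-- Independent inputs of distribution `p` satisfy the cost constraint with probability
exponentially close to `1`, in fact surely if `p` only charges letters that satisfy it. -/
theorem exists_cost_bound {α p : X → ℝ} {ρ : ℝ} (hp : p ∈ stdSimplex ℝ X)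
    (hcost : expectedCost α p < ρ ∨ ∀ x, p x ≠ 0 → α x ≤ ρ) :
    ∃ r : ℝ, 0 ≤ r ∧ r < 1 ∧ ∀ N : ℕ,
      ∑ x : Fin N → X with ¬ ∑ n, α (x n) ≤ N * ρ, ∏ n, p (x n) ≤ r ^ N := by
  classical
  rcases hcost with h | h
  · obtain ⟨r, h0, h1, hr⟩ := exists_sum_prod_le_pow hp h
    refine ⟨r, h0, h1, fun N => (Finset.sum_le_sum_of_subset_of_nonneg (fun x hx => ?_)
      fun x _ _ => Finset.prod_nonneg fun n _ => hp.1 _).trans (hr N)⟩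
    simp only [Finset.mem_filter, Finset.mem_univ, true_and, not_le] at hx ⊢
    exact hx.le
  · refine ⟨0, le_rfl, zero_lt_one, fun N => (le_of_eq ?_).trans (pow_nonneg le_rfl N)⟩
    refine Finset.sum_eq_zero fun x hx => ?_
    by_contra hne
    refine (Finset.mem_filter.1 hx).2 ?_
    have hne := Finset.prod_ne_zero_iff.1 hne
    calc ∑ n, α (x n) ≤ ∑ _n : Fin N, ρ := Finset.sum_le_sum fun n hn => h _ (hne n hn)
      _ = N * ρ := by simp

/-- The information density of `N` independent letters falls below `N * γ`, for `γ < I(X;Y)`, with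
exponentially small probability. -/
theorem exists_infoDensity_bound (hW : IsChannel W) {p : X → ℝ} (hp : p ∈ stdSimplex ℝ X) {γ : ℝ}
    (hγ : γ < mutualInfo W p) :
    ∃ r : ℝ, 0 ≤ r ∧ r < 1 ∧ ∀ N : ℕ,
      ∑ x : Fin N → X, ∑ y : Fin N → Y with
        ¬ Real.exp (N * γ) * ∏ n, outputDist W p (y n) ≤ ∏ n, W (x n) (y n),
        (∏ n, p (x n)) * ∏ n, W (x n) (y n) ≤ r ^ N := by
  classical
  obtain ⟨r, h0, h1, hr⟩ := exists_sum_prod_le_pow (joint_mem_stdSimplex hW hp) (γ := -γ)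
    (f := fun z => -Real.log (W z.1 z.2 / outputDist W p z.2)) (by
      rw [Fintype.sum_prod_type]
      simp only [mul_neg, Finset.sum_neg_distrib, mul_assoc, ← Finset.mul_sum]
      rw [← mutualInfo_eq_sum_log_div hW]
      linarith)
  refine ⟨r, h0, h1, fun N => le_trans ?_ (hr N)⟩
  have key : ∀ (x : Fin N → X) (y : Fin N → Y),
      (if ¬ Real.exp (N * γ) * ∏ n, outputDist W p (y n) ≤ ∏ n, W (x n) (y n)
        then (∏ n, p (x n)) * ∏ n, W (x n) (y n) else 0) ≤
      if N * -γ ≤ ∑ n, -Real.log (W (x n) (y n) / outputDist W p (y n))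
        then ∏ n, p (x n) * W (x n) (y n) else 0 := by
    intro x y
    rw [← Finset.prod_mul_distrib]
    have hnn : ∀ n, 0 ≤ p (x n) * W (x n) (y n) := fun n => mul_nonneg (hp.1 _) ((hW _).1 _)
    rcases (Finset.prod_nonneg fun n (_ : n ∈ Finset.univ) => hnn n).eq_or_lt with hz | hpos
    · rw [← hz]
      simp
    -- On the support of the joint distribution both conditions compare the same logarithms.
    have hne : ∀ n, 0 < p (x n) * W (x n) (y n) := fun n =>
      (hnn n).lt_of_ne' (Finset.prod_ne_zero_iff.1 hpos.ne' n (Finset.mem_univ n))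
    have hq : ∀ n, 0 < outputDist W p (y n) := fun n => outputDist_pos hW hp (hne n)
    have hw : ∀ n, 0 < W (x n) (y n) := fun n => pos_of_mul_pos_right (hne n) (hp.1 _)
    by_cases ha : Real.exp (N * γ) * ∏ n, outputDist W p (y n) ≤ ∏ n, W (x n) (y n)
    · rw [if_neg (not_not.2 ha)]
      split_ifs
      · exact hpos.le
      · exact le_rfl
    · rw [if_pos ha, if_pos]
      rw [not_le] at ha
      have h2 := Real.log_lt_log (Finset.prod_pos fun n _ => hw n) ha
      rw [Real.log_mul (Real.exp_ne_zero _) (Finset.prod_pos fun n _ => hq n).ne', Real.log_exp,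
        Real.log_prod (fun n _ => (hw n).ne'), Real.log_prod (fun n _ => (hq n).ne')] at h2
      simp only [Real.log_div (hw _).ne' (hq _).ne', Finset.sum_neg_distrib,
        Finset.sum_sub_distrib]
      linarith
  rw [Finset.sum_filter, ← (Equiv.arrowProdEquivProdArrow (Fin N) (fun _ => X)
    (fun _ => Y)).symm.sum_comp, Fintype.sum_prod_type]
  refine Finset.sum_le_sum fun x _ => ?_
  rw [Finset.sum_filter]
  exact Finset.sum_le_sum fun y _ => key x y

/-- Every rate below the mutual information of an input distribution is achievable, provided that
long independent sequences of that distribution satisfy the cost constraint. -/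
theorem isAchievable_of_lt_mutualInfo (hW : IsChannel W) {α p : X → ℝ} {ρ R : ℝ}
    (hp : p ∈ stdSimplex ℝ X) (hcost : expectedCost α p < ρ ∨ ∀ x, p x ≠ 0 → α x ≤ ρ)
    (hR : R < mutualInfo W p) : IsAchievable W α ρ R := by
  classical
  obtain ⟨γ, hRγ, hγ⟩ := exists_between hR
  obtain ⟨r₁, h₁0, h₁1, h₁⟩ := exists_cost_bound hp hcost
  obtain ⟨r₂, h₂0, h₂1, h₂⟩ := exists_infoDensity_bound hW hp hγ
  have hlim : Tendsto (fun N : ℕ => r₁ ^ N + r₂ ^ N + Real.exp (R - γ) ^ N) atTop (nhds 0) := by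
    simpa using ((tendsto_pow_atTop_nhds_zero_of_lt_one h₁0 h₁1).add
      (tendsto_pow_atTop_nhds_zero_of_lt_one h₂0 h₂1)).add
      (tendsto_pow_atTop_nhds_zero_of_lt_one (Real.exp_pos (R - γ)).le
        (Real.exp_lt_one_iff.2 (by linarith)))
  intro ε hε
  filter_upwards [hlim.eventually_lt_const (lt_min hε zero_lt_one), eventually_gt_atTop 0]
    with N hN hN0
  have hN' : (0 : ℝ) < N := by exact_mod_cast hN0
  have hM : 0 < ⌈Real.exp ((N : ℝ) * R)⌉₊ := Nat.ceil_pos.2 (Real.exp_pos _)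
  have hM' : (0 : ℝ) < (⌈Real.exp ((N : ℝ) * R)⌉₊ : ℝ) := by exact_mod_cast hM
  set P : (Fin N → X) → ℝ := fun x => ∏ n, p (x n) with hPdef
  set V : (Fin N → X) → (Fin N → Y) → ℝ := fun x y => ∏ n, W (x n) (y n) with hVdef
  set Q : (Fin N → Y) → ℝ := fun y => ∏ n, outputDist W p (y n) with hQdef
  set S : Finset (Fin N → X) := {x | ∑ n, α (x n) ≤ N * ρ} with hS
  set T : (Fin N → X) → Finset (Fin N → Y) := fun x =>
    {y | Real.exp (N * γ) * Q y ≤ V x y} with hTdef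
  have hP : P ∈ stdSimplex ℝ (Fin N → X) := prod_mem_stdSimplex hp N
  have hV0 : ∀ x y, 0 ≤ V x y := fun x y => Finset.prod_nonneg fun n _ => (hW _).1 _
  have hV1 : ∀ x, ∑ y, V x y = 1 := fun x => sum_prod_eq_one fun k => (hW (x k)).2
  have hQ : ∀ y, ∑ x, P x * V x y = Q y := by
    intro y
    simp only [hPdef, hVdef, hQdef, outputDist, ← Finset.prod_mul_distrib]
    exact (Fintype.prod_sum (fun n x => p x * W x (y n))).symm
  have hT : ∀ x ∈ S, ∑ y ∈ T x, Q y ≤ Real.exp (-(N * γ)) := by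
    intro x _
    calc ∑ y ∈ T x, Q y ≤ ∑ y ∈ T x, Real.exp (-(N * γ)) * V x y := by
          refine Finset.sum_le_sum fun y hy => ?_
          have := (Finset.mem_filter.1 hy).2
          rwa [Real.exp_neg, ← div_eq_inv_mul, le_div_iff₀' (Real.exp_pos _)]
      _ = Real.exp (-(N * γ)) * ∑ y ∈ T x, V x y := by rw [Finset.mul_sum]
      _ ≤ Real.exp (-(N * γ)) * 1 := by
          refine mul_le_mul_of_nonneg_left ?_ (Real.exp_pos _).le
          rw [← hV1 x]
          exact Finset.sum_le_univ_sum_of_nonneg (hV0 x)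
      _ = _ := mul_one _
  have hgood : 1 - r₁ ^ N - r₂ ^ N ≤ ∑ x ∈ S, P x * ∑ y ∈ T x, V x y := by
    have e1 : ∑ x ∈ S, P x + ∑ x with ¬ ∑ n, α (x n) ≤ N * ρ, P x = 1 := by
      rw [Finset.sum_filter_add_sum_filter_not]
      exact hP.2
    have e2 : ∀ x, P x = P x * ∑ y ∈ T x, V x y +
        ∑ y with ¬ Real.exp (N * γ) * Q y ≤ V x y, P x * V x y := by
      intro x
      rw [← Finset.mul_sum, ← mul_add, Finset.sum_filter_add_sum_filter_not, hV1, mul_one]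
    have e3 : ∑ x ∈ S, P x = ∑ x ∈ S, P x * ∑ y ∈ T x, V x y +
        ∑ x ∈ S, ∑ y with ¬ Real.exp (N * γ) * Q y ≤ V x y, P x * V x y := by
      rw [← Finset.sum_add_distrib]
      exact Finset.sum_congr rfl fun x _ => e2 x
    have e4 : ∑ x ∈ S, ∑ y with ¬ Real.exp (N * γ) * Q y ≤ V x y, P x * V x y ≤ r₂ ^ N :=
      (Finset.sum_le_univ_sum_of_nonneg fun x => Finset.sum_nonneg fun y _ =>
        mul_nonneg (hP.1 x) (hV0 x y)).trans (h₂ N)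
    have e5 := h₁ N
    linarith
  have hk : ∀ k < ⌈Real.exp ((N : ℝ) * R)⌉₊,
      1 - min ε 1 + k * Real.exp (-(N * γ)) < ∑ x ∈ S, P x * ∑ y ∈ T x, V x y := by
    intro k hk
    have h3 : k * Real.exp (-(N * γ)) ≤ Real.exp (R - γ) ^ N := by
      calc k * Real.exp (-(N * γ)) ≤ Real.exp (N * R) * Real.exp (-(N * γ)) :=
            mul_le_mul_of_nonneg_right (Nat.lt_ceil.1 hk).le (Real.exp_pos _).le
        _ = Real.exp (R - γ) ^ N := by
            rw [← Real.exp_add, ← Real.exp_nat_mul]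
            ring_nf
    linarith
  obtain ⟨enc, D, hencS, hdisj, hD⟩ :=
    exists_code_of_forall_lt hP hV0 hQ hT (min_le_right ε 1) hk
  obtain ⟨c, rfl, herr⟩ := exists_blockCode_of_disjoint hW hM enc D hdisj hD
  refine ⟨c, ?_, herr.trans (min_le_left _ _)⟩
  rw [BlockCode.averageCost, ← Finset.mul_sum, Finset.sum_comm, one_div, one_div,
    inv_mul_le_iff₀ hN', inv_mul_le_iff₀ hM']
  calc ∑ m, ∑ n, α (c.enc m n) ≤ ∑ _m : Fin _, (N : ℝ) * ρ :=
        Finset.sum_le_sum fun m _ => (Finset.mem_filter.1 (hencS m)).2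
    _ = _ := by simp

/-- Moving an optimal input slightly towards a letter of cost below `ρ` makes the constraint strict
at little loss of mutual information. If there is no such letter, a feasible input only charges
letters of cost exactly `ρ`. -/
theorem isAchievable_of_mem_feasibleInputs (hW : IsChannel W) {α p : X → ℝ} {ρ R : ℝ}
    (hp : p ∈ feasibleInputs α ρ) (hR : R < mutualInfo W p) : IsAchievable W α ρ R := by
  by_cases hx : ∃ x, α x < ρ
  · obtain ⟨x, hx⟩ := hx
    obtain ⟨p₀, hp₀, hcost⟩ := exists_mem_stdSimplex_expectedCost_eq α x
    have hlim : Tendsto (fun t : ℝ => (1 - t) * mutualInfo W p + t * mutualInfo W p₀)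
        (nhdsWithin 0 (Set.Ioi 0)) (nhds (mutualInfo W p)) := by
      have h : Continuous fun t : ℝ => (1 - t) * mutualInfo W p + t * mutualInfo W p₀ := by
        fun_prop
      simpa using (h.tendsto 0).mono_left nhdsWithin_le_nhds
    obtain ⟨t, ht, ht0, ht1⟩ := ((hlim.eventually_const_lt hR).and
      (Ioo_mem_nhdsGT (zero_lt_one (α := ℝ)))).exists
    have h1t : 0 ≤ 1 - t := by linarith
    refine isAchievable_of_lt_mutualInfo hW
      (convex_stdSimplex ℝ X hp.1 hp₀ h1t ht0.le (by ring)) (Or.inl ?_)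
      (ht.trans_le ((concaveOn_mutualInfo hW).2 hp.1 hp₀ h1t ht0.le (by ring)))
    rw [expectedCost_add_smul, hcost]
    have h1 := mul_le_mul_of_nonneg_left hp.2 h1t
    have h2 := mul_lt_mul_of_pos_left hx ht0
    linarith
  · push Not at hx
    refine isAchievable_of_lt_mutualInfo hW hp.1 (Or.inr fun x hpx => ?_) hR
    have hnn : ∀ x ∈ Finset.univ, 0 ≤ p x * (α x - ρ) := fun x _ =>
      mul_nonneg (hp.1.1 x) (sub_nonneg.2 (hx x))
    have hsum : ∑ x, p x * (α x - ρ) = expectedCost α p - ρ := by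
      simp only [mul_sub, Finset.sum_sub_distrib, ← Finset.sum_mul, hp.1.2, one_mul, expectedCost]
    have hzero := (Finset.sum_eq_zero_iff_of_nonneg hnn).1
      (le_antisymm (by rw [hsum]; linarith [hp.2]) (Finset.sum_nonneg hnn)) x (Finset.mem_univ x)
    linarith [(mul_eq_zero.1 hzero).resolve_left hpx]

end Achievability

/-! ### The capacity-cost theorem -/

theorem isCapacity_of_isGreatest {X Y : Type*} [Fintype X] [Fintype Y] [Nonempty X]
    {W : X → Y → ℝ} (hW : IsChannel W) {α : X → ℝ} {ρ C : ℝ}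
    (hC : IsGreatest (mutualInfo W '' feasibleInputs α ρ) C) : IsCapacity W α ρ C := by
  refine ⟨fun R hR => le_of_isAchievable hW (isGLB_dualFunction hW hC) hR,
    fun b hb => le_of_forall_lt fun R hR => ?_⟩
  obtain ⟨p, hp, rfl⟩ := hC.1
  obtain ⟨R', h1, h2⟩ := exists_between hR
  exact h1.trans_le (hb (isAchievable_of_mem_feasibleInputs hW hp h2))

theorem mainTheorem2 {X Y : Type*} [Fintype X] [Fintype Y] (W : X → Y → ℝ)
    (hW : IsChannel W) (α : X → ℝ) (ρ₀ : ℝ) (hfeas : ∃ x, α x ≤ ρ₀) :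
    (∀ lam : ℝ, 0 ≤ lam →
      IsGreatest (lagrangian W α lam ρ₀ '' stdSimplex ℝ X) (dualFunction W α lam ρ₀)) ∧
    ∃ C : ℝ,
      IsCapacity W α ρ₀ C ∧
      IsGreatest (mutualInfo W '' feasibleInputs α ρ₀) C ∧
      IsGLB ((fun lam => dualFunction W α lam ρ₀) '' Set.Ici 0) C ∧
      (((∃ x, α x < ρ₀) ∨ (∀ x, α x ≤ ρ₀)) →
        IsLeast ((fun lam => dualFunction W α lam ρ₀) '' Set.Ici 0) C) ∧
      (∀ lamStar : ℝ, 0 ≤ lamStar → dualFunction W α lamStar ρ₀ = C →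
        ∀ (N : ℕ) (p : Fin N → X → ℝ), (∀ n, p n ∈ stdSimplex ℝ X) →
          (1 / (N : ℝ)) * ∑ n, expectedCost α (p n) ≤ ρ₀ →
            ∑ n, mutualInfo W (p n) ≤
              ∑ n, (mutualInfo W (p n) - lamStar * (expectedCost α (p n) - ρ₀)) ∧
            ∑ n, (mutualInfo W (p n) - lamStar * (expectedCost α (p n) - ρ₀)) ≤ N * C) := by
  obtain ⟨x₀, hx₀⟩ := hfeas
  have : Nonempty X := ⟨x₀⟩
  obtain ⟨p₀, hp₀, hcost⟩ := exists_mem_stdSimplex_expectedCost_eq α x₀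
  have hC := ((isCompact_feasibleInputs α ρ₀).image_of_continuousOn
    ((continuousOn_mutualInfo hW).mono fun p hp => hp.1)).isGreatest_sSup
      (Set.Nonempty.image _ ⟨p₀, hp₀, hcost.trans_le hx₀⟩)
  refine ⟨fun lam _ => isGreatest_dualFunction hW α lam ρ₀, _, isCapacity_of_isGreatest hW hC, hC,
    isGLB_dualFunction hW hC, ?_, ?_⟩
  · rintro (hx | hα)
    · exact isLeast_dualFunction_of_slater hW (isGLB_dualFunction hW hC) hx
    · exact isLeast_dualFunction_of_forall_le hW hC hα
  · intro lam hlam hdual N p hp hN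
    refine ⟨sum_mutualInfo_le_sum_lagrangian hlam hN, ?_⟩
    rw [← hdual]
    exact sum_lagrangian_le_mul_dualFunction hW α lam ρ₀ hp
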